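/- Let $G$ and $H$ be finite groups with the same character table, that is, suppose there are bijections $\alpha:\mathrm{Irr}(G)\to\mathrm{Irr}(H)$ between the sets of irreducible complex characters and $\beta:\mathrm{Cl}(G)\to\mathrm{Cl}(H)$ between the sets of conjugacy classes such that $\alpha(\chi)(\beta(c))=\chi(c)$ for all $\chi\in\mathrm{Irr}(G)$ and $c\in\mathrm{Cl}(G)$. Let $N$ be a normal subgroup of $G$ and $M$ a normal subgroup of $H$ such that $\beta$ maps the set of conjugacy classes of $G$ contained in $N$ onto the set of conjugacy classes of $H$ contained in $M$. Then $N$ is nilpotent if and only if $M$ is nilpotent, and $N$ is solvable if and only if $M$ is solvable. In other words, the character table of a finite group $G$ determines, for every normal subgroup $N$ of $G$ (given by the columns of the table that belong to $N$), whether $N$ is nilpotent and whether $N$ is solvable. -/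

import Mathlib

noncomputable section

/-- The set `Irr(G)` of irreducible complex characters of `G`: the functions `g ↦ tr (ρ g)`, where
`ρ` is an irreducible representation of `G` on some `ℂⁿ`. -/
def Irr (G : Type*) [Group G] : Set (G → ℂ) :=
  {χ | ∃ (n : ℕ) (ρ : Representation ℂ G (Fin n → ℂ)), ρ.IsIrreducible ∧ χ = ρ.character}

theorem Irr.eq_of_isConj {G : Type*} [Group G] (χ : Irr G) {g h : G} (hgh : IsConj g h) :
    (χ : G → ℂ) g = (χ : G → ℂ) h := by
  obtain ⟨_, n, ρ, -, rfl⟩ := χ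
  obtain ⟨c, rfl⟩ := isConj_iff.mp hgh
  exact (ρ.char_conj g c).symm

/-- The character table of `G`: its rows are indexed by the irreducible complex characters of `G`,
its columns by the conjugacy classes of `G`, and the entry at `(χ, gᴳ)` is `χ g`. -/
def characterTable (G : Type*) [Group G] : Matrix (Irr G) (ConjClasses G) ℂ :=
  Matrix.of fun χ c => Quotient.liftOn c (χ : G → ℂ) fun _ _ h => Irr.eq_of_isConj χ h

/-- The conjugacy classes of `G` that meet the subgroup `N`; for a normal subgroup these are the
classes contained in `N`, and `N` is their union. -/
def classesIn {G : Type*} [Group G] (N : Subgroup G) : Set (ConjClasses G) :=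
  ConjClasses.mk '' (N : Set G)

end

/-! ### Characters of complex representations -/

section

open Polynomial

/-! A normal subgroup is the intersection of the kernels of the irreducible characters trivial on it
(`mem_of_forall_ker`), and these kernels are visible in the table once the column of the identity is
known (`map_one`). So each normal subgroup of `G` has a normal counterpart in `H`, in the same
columns (`exists_corresponds`). Counterparts have equal orders (`Corresponds.card_eq`), since the
table determines the mean of an indicator function through its expansion in irreducible characters.

For nilpotency, a normal Sylow subgroup of `N` is characteristic, hence normal in `G`, and its
counterpart is a normal Sylow subgroup of `M`. For solvability, induct on the order of `N`: some
prime `p` makes `N'Nᵖ` proper, and the quotient of `M` by its counterpart has `p`-power order. -/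

theorem Module.End.eq_one_of_pow_eq_one {V : Type*} [AddCommGroup V] [Module ℂ V]
    [FiniteDimensional ℂ V] {f : Module.End ℂ V} {m : ℕ} (hm : m ≠ 0) (hf : f ^ m = 1)
    (h : ∀ μ, f.HasEigenvalue μ → μ = 1) : f = 1 := by
  have hdvd : minpoly ℂ f ∣ X ^ m - 1 := minpoly.dvd ℂ f (by simp [hf])
  have hsep : (X ^ m - 1 : ℂ[X]).Separable :=
    X_pow_sub_one_separable_iff.mpr (by exact_mod_cast hm)
  have hnd : (minpoly ℂ f).roots.Nodup := nodup_roots (hsep.of_dvd hdvd)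
  have hmon : (minpoly ℂ f).Monic := minpoly.monic (Algebra.IsIntegral.isIntegral f)
  have hle : (minpoly ℂ f).roots ≤ {1} := by
    rw [Multiset.le_iff_subset hnd]
    intro μ hμ
    rw [Multiset.mem_singleton]
    exact h μ (Module.End.hasEigenvalue_of_isRoot (isRoot_of_mem_roots hμ))
  have hX : minpoly ℂ f ∣ X - C 1 := by
    rw [(IsAlgClosed.splits (minpoly ℂ f)).eq_prod_roots_of_monic hmon]
    simpa using Multiset.prod_dvd_prod_of_le (Multiset.map_le_map (f := fun a => X - C a) hle)
  have := (minpoly.dvd_iff (A := ℂ)).mp hX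
  simpa [sub_eq_zero] using this

theorem Multiset.re_sum_add_eq_card {s : Multiset ℂ} :
    s.sum.re + (s.map fun z => 1 - z.re).sum = s.card := by
  induction s using Multiset.induction_on with
  | empty => simp
  | cons a s ih =>
    simp only [Multiset.sum_cons, Complex.add_re, Multiset.map_cons, Multiset.card_cons,
      Nat.cast_add, Nat.cast_one]
    linarith

namespace Representation

variable {G : Type*} [Group G] [Finite G]

section
variable {V : Type*} [AddCommGroup V] [Module ℂ V] [FiniteDimensional ℂ V]
  (ρ : Representation ℂ G V)

omit [FiniteDimensional ℂ V] in
theorem norm_eq_one_of_hasEigenvalue {g : G} {μ : ℂ} (h : Module.End.HasEigenvalue (ρ g) μ) : ‖μ‖ = 1 := by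
  obtain ⟨v, hv⟩ := h.exists_hasEigenvector
  have h1 := hv.pow_apply (orderOf g)
  rw [← map_pow, pow_orderOf_eq_one, map_one, Module.End.one_apply] at h1
  have h2 : μ ^ orderOf g = 1 := by
    by_contra hne
    have : (μ ^ orderOf g - 1) • v = 0 := by rw [sub_smul, one_smul, ← h1, sub_self]
    exact (smul_eq_zero.mp this).elim (fun h => hne (sub_eq_zero.mp h)) hv.2
  exact Complex.norm_eq_one_of_pow_eq_one h2 (orderOf_pos g).ne'

theorem norm_eq_one_of_mem_roots_charpoly {g : G} {μ : ℂ} (h : μ ∈ (ρ g).charpoly.roots) :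
    ‖μ‖ = 1 :=
  ρ.norm_eq_one_of_hasEigenvalue
    (Module.End.hasEigenvalue_iff_isRoot_charpoly _ _ |>.mpr (isRoot_of_mem_roots h))

omit [Finite G] in
theorem character_eq_sum_roots (g : G) : ρ.character g = (ρ g).charpoly.roots.sum :=
  Module.End.trace_eq_sum_roots_charpoly_of_splits (IsAlgClosed.splits _)

omit [Finite G] in
theorem card_roots_charpoly (g : G) :
    (ρ g).charpoly.roots.card = Module.finrank ℂ V := by
  rw [← (IsAlgClosed.splits (ρ g).charpoly).natDegree_eq_card_roots, LinearMap.charpoly_natDegree]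

theorem norm_character_le (g : G) : ‖ρ.character g‖ ≤ Module.finrank ℂ V := by
  rw [character_eq_sum_roots, ← ρ.card_roots_charpoly g]
  refine (norm_multiset_sum_le _).trans_eq ?_
  rw [Multiset.map_congr rfl fun μ hμ => ρ.norm_eq_one_of_mem_roots_charpoly hμ]
  simp

/-- Eigenvalues on the unit circle whose sum equals their number must all be 1, and `ρ g` has finite
order, so it is diagonalizable. -/
theorem eq_one_of_character_eq {g : G} (h : ρ.character g = Module.finrank ℂ V) : ρ g = 1 := by
  refine Module.End.eq_one_of_pow_eq_one (orderOf_pos g).ne'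
    (by rw [← map_pow, pow_orderOf_eq_one, map_one]) fun μ hμ => ?_
  have hroot : μ ∈ (ρ g).charpoly.roots :=
    (mem_roots (LinearMap.charpoly_monic _).ne_zero).mpr
      ((Module.End.hasEigenvalue_iff_isRoot_charpoly _ _).mp hμ)
  have hsum := Multiset.re_sum_add_eq_card (s := (ρ g).charpoly.roots)
  rw [← character_eq_sum_roots, h, card_roots_charpoly, Complex.natCast_re, add_eq_left] at hsum
  have hnonneg : ∀ x ∈ (ρ g).charpoly.roots.map fun z => 1 - z.re, 0 ≤ x := by
    simp only [Multiset.mem_map]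
    rintro _ ⟨z, hz, rfl⟩
    have := (Complex.re_le_norm z).trans_eq (ρ.norm_eq_one_of_mem_roots_charpoly hz)
    linarith
  have hre : 1 - μ.re = 0 :=
    Multiset.all_zero_of_le_zero_le_of_sum_eq_zero hnonneg hsum _
      (Multiset.mem_map_of_mem (fun z : ℂ => 1 - z.re) hroot)
  have hnorm := ρ.norm_eq_one_of_mem_roots_charpoly hroot
  have hsq : μ.re * μ.re + μ.im * μ.im = 1 := by
    rw [← Complex.normSq_apply, Complex.normSq_eq_norm_sq, hnorm, one_pow]
  apply Complex.ext
  · simp; linarith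
  · have : μ.re = 1 := by linarith
    rw [this] at hsq
    simpa using hsq

end

omit [Finite G] in
theorem IsIrreducible.congr {V W : Type*} [AddCommGroup V] [Module ℂ V] [AddCommGroup W]
    [Module ℂ W] {ρ : Representation ℂ G V} {σ : Representation ℂ G W} (e : ρ.Equiv σ)
    [ρ.IsIrreducible] : σ.IsIrreducible := by
  rw [irreducible_iff_isSimpleModule_asModule]
  let f := IntertwiningMap.equivLinearMapAsModule ρ σ e.toIntertwiningMap
  have hf : Function.Bijective f := e.toLinearEquiv.bijective
  exact IsSimpleModule.congr (LinearEquiv.ofBijective f hf).symm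

omit [Finite G] in
theorem character_mem_irr {V : Type*} [AddCommGroup V] [Module ℂ V] [FiniteDimensional ℂ V]
    (ρ : Representation ℂ G V) [ρ.IsIrreducible] : ρ.character ∈ Irr G := by
  let e := (Module.finBasis ℂ V).equivFun
  let σ : Representation ℂ G (Fin (Module.finrank ℂ V) → ℂ) :=
    (e.conjAlgEquiv ℂ : _ →* _).comp ρ
  let f : ρ.Equiv σ := .mk e fun g => by ext; simp [σ]
  exact ⟨_, σ, IsIrreducible.congr f, char_iso f⟩

omit [Finite G] in
theorem character_eq_add_of_isCompl {V : Type*} [AddCommGroup V] [Module ℂ V]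
    [FiniteDimensional ℂ V] {ρ : Representation ℂ G V} {W W' : Subrepresentation ρ}
    (h : IsCompl W.toSubmodule W'.toSubmodule) :
    ρ.character = W.toRepresentation.character + W'.toRepresentation.character := by
  ext g
  have : ρ g = (Submodule.prodEquivOfIsCompl _ _ h).conj
      ((W.toRepresentation g).prodMap (W'.toRepresentation g)) := by
    rw [LinearEquiv.conj_apply, LinearEquiv.eq_comp_toLinearMap_symm]
    ext x <;> simp [Subrepresentation.toRepresentation]
  rw [character, this, LinearMap.trace_conj', LinearMap.trace_prodMap']
  rfl

/-- The irreducible characters of `G` whose kernel contains `K`. -/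
def irrTrivialOn (K : Subgroup G) : Set (G → ℂ) := {χ ∈ Irr G | ∀ k ∈ K, χ k = χ 1}

theorem character_mem_span_irrTrivialOn (K : Subgroup G) {V : Type*} [AddCommGroup V] [Module ℂ V]
    [FiniteDimensional ℂ V] (ρ : Representation ℂ G V) (hρ : ∀ k ∈ K, ρ k = 1) :
    ρ.character ∈ Submodule.span ℂ (irrTrivialOn K) := by
  induction hn : Module.finrank ℂ V using Nat.strong_induction_on generalizing V with
  | _ n ih =>
  by_cases hirr : ρ.IsIrreducible
  · refine Submodule.subset_span ⟨ρ.character_mem_irr, fun k hk => ?_⟩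
    rw [character, character, hρ k hk, map_one ρ]
  rcases subsingleton_or_nontrivial V with hV | hV
  · have : ρ.character = 0 := by
      ext g
      rw [character, Subsingleton.elim (ρ g) 0, map_zero, Pi.zero_apply]
    rw [this]
    exact Submodule.zero_mem _
  have hnt : Nontrivial (Subrepresentation ρ) :=
    ⟨⊥, ⊤, fun h => bot_ne_top (α := Submodule ℂ V) (congrArg Subrepresentation.toSubmodule h)⟩
  obtain ⟨W, hW⟩ : ∃ W : Subrepresentation ρ, ¬ (W = ⊥ ∨ W = ⊤) := by
    by_contra! hall
    exact hirr ⟨fun W => hall W⟩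
  push Not at hW
  -- Maschke's theorem.
  obtain ⟨W', hWW'⟩ := exists_isCompl W
  have hcompl : IsCompl W.toSubmodule W'.toSubmodule :=
    ⟨disjoint_iff.mpr (congrArg Subrepresentation.toSubmodule hWW'.1.eq_bot),
      codisjoint_iff.mpr (congrArg Subrepresentation.toSubmodule hWW'.2.eq_top)⟩
  have hres : ∀ U : Subrepresentation ρ, ∀ k ∈ K, U.toRepresentation k = 1 := fun U k hk => by
    ext x
    simp [Subrepresentation.toRepresentation, hρ k hk]
  have hlt : ∀ U : Subrepresentation ρ, U ≠ ⊤ → Module.finrank ℂ U.toSubmodule < n :=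
    fun U hU => hn ▸ Submodule.finrank_lt fun h => hU (Subrepresentation.toSubmodule_injective h)
  have hW' : W' ≠ ⊤ := by
    rintro rfl
    exact hW.1 (by simpa using hWW'.1.eq_bot)
  rw [character_eq_add_of_isCompl hcompl]
  exact Submodule.add_mem _ (ih _ (hlt W hW.2) _ (hres W) rfl) (ih _ (hlt W' hW') _ (hres W') rfl)

/-- The permutation representation of `G` on the functions on a `G`-set. -/
def funAction (G X : Type*) [Group G] [MulAction G X] : Representation ℂ G (X → ℂ) where
  toFun g := LinearMap.funLeft ℂ ℂ (g⁻¹ • ·)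
  map_one' := by ext; simp [LinearMap.funLeft_apply]
  map_mul' g h := by ext; simp [LinearMap.funLeft_apply, mul_smul]

omit [Finite G] in
theorem character_funAction {X : Type*} [MulAction G X] [Fintype X] [DecidableEq X] (g : G) :
    (funAction G X).character g = ∑ x : X, if g⁻¹ • x = x then 1 else 0 := by
  rw [character, LinearMap.trace_eq_matrix_trace ℂ (Pi.basisFun ℂ X), Matrix.trace]
  simp [funAction, LinearMap.funLeft_apply, Pi.single_apply]

/-- Up to the factor `|G : K|`, the indicator is the permutation character on `G ⧸ K`, where `K`
acts trivially. -/
theorem indicator_mem_span_irrTrivialOn (K : Subgroup G) [K.Normal] :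
    (K : Set G).indicator 1 ∈ Submodule.span ℂ (irrTrivialOn K) := by
  classical
  have : Fintype (G ⧸ K) := Fintype.ofFinite _
  have hsmul : ∀ (g : G) (x : G ⧸ K), g⁻¹ • x = x ↔ g ∈ K := by
    intro g x
    induction x using QuotientGroup.induction_on with
    | H a =>
      rw [MulAction.Quotient.smul_coe, eq_comm, QuotientGroup.eq, smul_eq_mul, ← mul_assoc,
        ‹K.Normal›.mem_comm_iff, mul_inv_cancel_left, inv_mem_iff]
  have hchar : (K : Set G).indicator 1 =
      (Fintype.card (G ⧸ K) : ℂ)⁻¹ • (funAction G (G ⧸ K)).character := by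
    ext g
    rw [Pi.smul_apply, character_funAction]
    by_cases hg : g ∈ K <;> simp [hsmul, hg]
  rw [hchar]
  refine Submodule.smul_mem _ _ (character_mem_span_irrTrivialOn K _ fun k hk => ?_)
  refine LinearMap.ext fun f => funext fun x => ?_
  exact congrArg f ((hsmul k x).mpr hk)

end Representation

end

/-! ### Kernels and mean values of irreducible characters -/

section

open Representation

namespace Irr

variable {G : Type*} [Group G] [Finite G]

theorem norm_apply_le {χ : G → ℂ} (hχ : χ ∈ Irr G) (g : G) : ‖χ g‖ ≤ ‖χ 1‖ := by
  obtain ⟨n, ρ, -, rfl⟩ := hχ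
  rw [char_one, Complex.norm_natCast]
  exact ρ.norm_character_le g

omit [Finite G] in
theorem ofReal_norm_apply_one {χ : G → ℂ} (hχ : χ ∈ Irr G) : (‖χ 1‖ : ℂ) = χ 1 := by
  obtain ⟨n, ρ, -, rfl⟩ := hχ
  rw [char_one, Complex.norm_natCast, Complex.ofReal_natCast]

theorem exists_apply_eq_iff {χ : G → ℂ} (hχ : χ ∈ Irr G) :
    ∃ (n : ℕ) (ρ : Representation ℂ G (Fin n → ℂ)), ∀ g, χ g = χ 1 ↔ ρ g = 1 := by
  obtain ⟨n, ρ, -, rfl⟩ := hχ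
  refine ⟨n, ρ, fun g => ⟨fun h => ρ.eq_one_of_character_eq (h.trans ρ.char_one), fun h => ?_⟩⟩
  rw [character, character, h, map_one ρ]

/-- The kernel of an irreducible character. -/
def ker (χ : Irr G) : Subgroup G where
  carrier := {g | (χ : G → ℂ) g = (χ : G → ℂ) 1}
  one_mem' := rfl
  mul_mem' {a b} ha hb := by
    obtain ⟨n, ρ, h⟩ := exists_apply_eq_iff χ.2
    exact (h _).mpr (by rw [map_mul, (h a).mp ha, (h b).mp hb, one_mul])
  inv_mem' {a} ha := by
    obtain ⟨n, ρ, h⟩ := exists_apply_eq_iff χ.2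
    refine (h _).mpr ?_
    rw [← mul_one (ρ a⁻¹)]
    nth_rw 1 [← (h a).mp ha]
    rw [← map_mul, inv_mul_cancel, map_one]

theorem mem_ker {χ : Irr G} {g : G} : g ∈ ker χ ↔ (χ : G → ℂ) g = (χ : G → ℂ) 1 := Iff.rfl

instance ker_normal (χ : Irr G) : (ker χ).Normal where
  conj_mem n hn g := by
    rw [mem_ker] at *
    rw [← hn]
    exact eq_of_isConj χ (isConj_iff.mpr ⟨g⁻¹, by group⟩)

theorem mem_of_forall_ker (K : Subgroup G) [K.Normal] {g : G}
    (h : ∀ χ : Irr G, K ≤ ker χ → g ∈ ker χ) : g ∈ K := by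
  have hspan : ∀ f ∈ Submodule.span ℂ (irrTrivialOn K), f g = f 1 := fun f hf => by
    induction hf using Submodule.span_induction with
    | mem f hf => exact h ⟨f, hf.1⟩ fun k hk => hf.2 k hk
    | zero => rfl
    | add f f' _ _ hf hf' => rw [Pi.add_apply, Pi.add_apply, hf, hf']
    | smul c f _ hf => rw [Pi.smul_apply, Pi.smul_apply, hf]
  by_contra hg
  simpa [hg, K.one_mem] using hspan _ (indicator_mem_span_irrTrivialOn K)

omit [Finite G] in
theorem one_mem : (1 : G → ℂ) ∈ Irr G := by
  have : (trivial ℂ G ℂ).IsIrreducible := by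
    have hirr : ∀ W : Subrepresentation (trivial ℂ G ℂ), W = ⊥ ∨ W = ⊤ := fun W =>
      (eq_bot_or_eq_top W.toSubmodule).imp (fun h => Subrepresentation.toSubmodule_injective h)
        fun h => Subrepresentation.toSubmodule_injective h
    have : Nontrivial (Subrepresentation (trivial ℂ G ℂ)) :=
      ⟨⊥, ⊤, fun h => bot_ne_top (α := Submodule ℂ ℂ)
        (congrArg Subrepresentation.toSubmodule h)⟩
    exact ⟨hirr⟩
  convert (trivial ℂ G ℂ).character_mem_irr
  ext g
  simp [character]

/-- The mean value of a function on a finite group. -/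
noncomputable def mean (G : Type*) [Finite G] : (G → ℂ) →ₗ[ℂ] ℂ :=
  (Nat.card G : ℂ)⁻¹ • ∑ᶠ g : G, LinearMap.proj g

omit [Group G] in
theorem mean_apply [Fintype G] (f : G → ℂ) : mean G f = (Nat.card G : ℂ)⁻¹ * ∑ g, f g := by
  rw [mean, finsum_eq_sum_of_fintype]
  simp

omit [Group G] in
theorem mean_indicator (S : Set G) :
    mean G (S.indicator 1) = (Nat.card G : ℂ)⁻¹ * Nat.card S := by
  classical
  have := Fintype.ofFinite G
  rw [mean_apply]
  simp [Set.indicator_apply, Fintype.card_subtype]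

open scoped Classical in
theorem mean_irr {χ : G → ℂ} (hχ : χ ∈ Irr G) : mean G χ = if χ = 1 then 1 else 0 := by
  have := Fintype.ofFinite G
  have hcard : (Nat.card G : ℂ) ≠ 0 := by exact_mod_cast Nat.card_pos.ne'
  have := invertibleOfNonzero hcard
  split_ifs with h
  · simp [mean_apply, h]
  · obtain ⟨n, ρ, hρ, rfl⟩ := hχ
    obtain ⟨m, σ, hσ, h1⟩ := one_mem (G := G)
    have := char_orthonormal ρ σ
    -- The mean is the inner product with the trivial character.
    rw [if_neg fun ⟨e⟩ => h ((char_iso e).symm.trans h1.symm), ← h1] at this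
    simpa [mean_apply] using this

end Irr

/-! ### Normal subgroups read off the table -/

/-- The normal subgroups `K` and `L` occupy corresponding columns under the bijection `β`. -/
def ConjClasses.Corresponds {G H : Type*} [Group G] [Group H] (β : ConjClasses G ≃ ConjClasses H)
    (K : Subgroup G) (L : Subgroup H) : Prop :=
  ∀ g h, β (ConjClasses.mk g) = ConjClasses.mk h → (g ∈ K ↔ h ∈ L)

namespace characterTable

open Irr ConjClasses

variable {G H : Type*} [Group G] [Group H] {α : Irr G ≃ Irr H}
  {β : ConjClasses G ≃ ConjClasses H}

theorem apply_eq
    (hαβ : ∀ χ c, characterTable H (α χ) (β c) = characterTable G χ c) {g : G} {h : H}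
    (hgh : β (ConjClasses.mk g) = ConjClasses.mk h) (χ : Irr G) :
    (α χ : H → ℂ) h = (χ : G → ℂ) g := by
  have := hαβ χ (ConjClasses.mk g)
  rwa [hgh] at this

theorem symm_apply (hαβ : ∀ χ c, characterTable H (α χ) (β c) = characterTable G χ c)
    (χ : Irr H) (c : ConjClasses H) :
    characterTable G (α.symm χ) (β.symm c) = characterTable H χ c := by
  rw [← hαβ, α.apply_symm_apply, β.apply_symm_apply]

theorem exists_left (β : ConjClasses G ≃ ConjClasses H) (h : H) :
    ∃ g, β (ConjClasses.mk g) = ConjClasses.mk h := by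
  obtain ⟨g, hg⟩ := ConjClasses.mk_surjective (β.symm (ConjClasses.mk h))
  exact ⟨g, by rw [hg, β.apply_symm_apply]⟩

theorem exists_right (β : ConjClasses G ≃ ConjClasses H) (g : G) :
    ∃ h, β (ConjClasses.mk g) = ConjClasses.mk h :=
  (ConjClasses.mk_surjective (β (ConjClasses.mk g))).imp fun _ => Eq.symm

theorem _root_.ConjClasses.Corresponds.le {K K' : Subgroup G} {L L' : Subgroup H} (h : Corresponds β K L)
    (h' : Corresponds β K' L') (hK : K ≤ K') : L ≤ L' := fun x hx => by
  obtain ⟨g, hg⟩ := exists_left β x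
  exact (h' g x hg).mp (hK ((h g x hg).mpr hx))

theorem mk_mem_classesIn {K : Subgroup G} (hK : K.Normal) {g : G} :
    ConjClasses.mk g ∈ classesIn K ↔ g ∈ K := by
  refine ⟨?_, fun hg => ⟨g, hg, rfl⟩⟩
  rintro ⟨k, hk, hkg⟩
  obtain ⟨c, rfl⟩ := isConj_iff.mp (ConjClasses.mk_eq_mk_iff_isConj.mp hkg)
  exact hK.conj_mem k hk c

theorem mk_eq_mk_one_iff {g : G} : ConjClasses.mk g = ConjClasses.mk 1 ↔ g = 1 := by
  rw [ConjClasses.mk_eq_mk_iff_isConj, isConj_one_left]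

theorem _root_.ConjClasses.Corresponds.of_image_classesIn {N : Subgroup G} {M : Subgroup H}
    (hN : N.Normal) (hM : M.Normal) (h : β '' classesIn N = classesIn M) :
    Corresponds β N M := fun g x hgx => by
  rw [← mk_mem_classesIn hM, ← h, ← hgx, β.injective.mem_set_image, mk_mem_classesIn hN]

variable [Finite G] [Finite H]

theorem map_one (hαβ : ∀ χ c, characterTable H (α χ) (β c) = characterTable G χ c) :
    β (ConjClasses.mk 1) = ConjClasses.mk 1 := by
  obtain ⟨h, hh⟩ := exists_right β 1
  obtain ⟨g, hg⟩ := exists_left β 1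
  suffices g = 1 by rw [← hg, this]
  rw [← Subgroup.mem_bot]
  refine mem_of_forall_ker ⊥ fun χ _ => mem_ker.mpr ?_
  -- Here `g` matches the identity of `H`, and `h` matches that of `G`. Thus `‖χ 1‖ = ‖α χ h‖ ≤ ‖α χ
  -- 1‖ = ‖χ g‖`, while `χ g = α χ 1` is real and nonnegative.
  have hle := norm_apply_le (α χ).2 h
  have hreal := ofReal_norm_apply_one (α χ).2
  rw [apply_eq hαβ hg] at hle hreal
  rw [apply_eq hαβ hh] at hle
  rw [← hreal, ← ofReal_norm_apply_one χ.2, (norm_apply_le χ.2 g).antisymm hle]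

theorem exists_corresponds (hαβ : ∀ χ c, characterTable H (α χ) (β c) = characterTable G χ c)
    (K : Subgroup G) [K.Normal] : ∃ L : Subgroup H, L.Normal ∧ Corresponds β K L := by
  refine ⟨⨅ χ : {χ : Irr G // K ≤ ker χ}, ker (α χ), Subgroup.normal_iInf_normal fun _ =>
    inferInstance, fun g h hgh => ?_⟩
  have hker : ∀ χ : Irr G, h ∈ ker (α χ) ↔ g ∈ ker χ := fun χ => by
    rw [mem_ker, mem_ker, apply_eq hαβ hgh, apply_eq hαβ (map_one hαβ)]
  simp only [Subgroup.mem_iInf, hker, Subtype.forall]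
  exact ⟨fun hg χ hχ hK => hK hg, fun hall => mem_of_forall_ker K fun χ hχ => hall χ.1 χ.2 hχ⟩

open scoped Classical in
theorem exists_mean_eq (hαβ : ∀ χ c, characterTable H (α χ) (β c) = characterTable G χ c)
    {f : G → ℂ} (hf : f ∈ Submodule.span ℂ (Irr G)) :
    ∃ f' : H → ℂ, (∀ g h, β (ConjClasses.mk g) = ConjClasses.mk h → f' h = f g) ∧
      mean H f' = mean G f := by
  induction hf using Submodule.span_induction with
  | mem f hf =>
    refine ⟨α ⟨f, hf⟩, fun g h hgh => apply_eq hαβ hgh ⟨f, hf⟩, ?_⟩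
    rw [mean_irr (α ⟨f, hf⟩).2, mean_irr hf]
    -- The trivial character is the row of ones, so `α` preserves it.
    refine if_congr ⟨fun h1 => funext fun g => ?_, fun h1 => funext fun h => ?_⟩ rfl rfl
    · obtain ⟨h, hh⟩ := exists_right β g
      exact (apply_eq hαβ hh ⟨f, hf⟩).symm.trans (congrFun h1 h)
    · obtain ⟨g, hg⟩ := exists_left β h
      exact (apply_eq hαβ hg ⟨f, hf⟩).trans (congrFun h1 g)
  | zero => exact ⟨0, fun _ _ _ => rfl, by simp⟩
  | add f₁ f₂ _ _ h₁ h₂ =>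
    obtain ⟨f₁', h₁, e₁⟩ := h₁
    obtain ⟨f₂', h₂, e₂⟩ := h₂
    exact ⟨f₁' + f₂', fun g h hgh => by simp [h₁ g h hgh, h₂ g h hgh], by simp [e₁, e₂]⟩
  | smul c f _ h =>
    obtain ⟨f', h, e⟩ := h
    exact ⟨c • f', fun g x hgx => by simp [h g x hgx], by simp [e]⟩

theorem _root_.ConjClasses.Corresponds.card_div_card
    (hαβ : ∀ χ c, characterTable H (α χ) (β c) = characterTable G χ c)
    {K : Subgroup G} [K.Normal] {L : Subgroup H} (hKL : Corresponds β K L) :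
    (Nat.card H : ℂ)⁻¹ * Nat.card L = (Nat.card G : ℂ)⁻¹ * Nat.card K := by
  obtain ⟨f, hf, he⟩ := exists_mean_eq hαβ
    (Submodule.span_mono (Set.sep_subset _ _) (indicator_mem_span_irrTrivialOn K))
  have : f = (L : Set H).indicator 1 := by
    ext h
    obtain ⟨g, hg⟩ := exists_left β h
    rw [hf g h hg]
    by_cases hgK : g ∈ K
    · simp [hgK, (hKL g h hg).mp hgK]
    · simp [hgK, mt (hKL g h hg).mpr hgK]
  rw [this, mean_indicator, mean_indicator] at he
  exact he

theorem card_eq (hαβ : ∀ χ c, characterTable H (α χ) (β c) = characterTable G χ c) :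
    Nat.card H = Nat.card G := by
  have hbot : Corresponds β (⊥ : Subgroup G) (⊥ : Subgroup H) := fun g h hgh => by
    rw [Subgroup.mem_bot, Subgroup.mem_bot]
    rw [← mk_eq_mk_one_iff, ← mk_eq_mk_one_iff, ← hgh, ← map_one hαβ, β.apply_eq_iff_eq]
  simpa using hbot.card_div_card hαβ

theorem _root_.ConjClasses.Corresponds.card_eq (hαβ : ∀ χ c, characterTable H (α χ) (β c) = characterTable G χ c)
    {K : Subgroup G} [K.Normal] {L : Subgroup H} (hKL : Corresponds β K L) :
    Nat.card L = Nat.card K := by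
  have h := hKL.card_div_card hαβ
  have h0 : (Nat.card G : ℂ)⁻¹ ≠ 0 := by
    rw [ne_eq, inv_eq_zero]
    exact_mod_cast Nat.card_pos.ne'
  rw [characterTable.card_eq hαβ] at h
  exact_mod_cast mul_left_cancel₀ h0 h

end characterTable

end

/-! ### A proper characteristic subgroup with `p`-group quotient -/

namespace Subgroup

/-- The elements of `N` that are `p`-th powers modulo the commutator subgroup of `N`. -/
def commutatorPow (N : Type*) [Group N] (p : ℕ) : Subgroup N :=
  (powMonoidHom p : Abelianization N →* Abelianization N).range.comap Abelianization.of

variable {N : Type*} [Group N] {p : ℕ}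

theorem pow_mem_commutatorPow (n : N) : n ^ p ∈ commutatorPow N p :=
  ⟨Abelianization.of n, by simp⟩

instance commutatorPow_characteristic : (commutatorPow N p).Characteristic := by
  rw [characteristic_iff_le_comap]
  rintro φ n ⟨a, ha⟩
  exact ⟨Abelianization.map φ.toMonoidHom a, by
    rw [powMonoidHom_apply] at ha ⊢
    rw [← map_pow, ha, Abelianization.map_of]⟩

theorem exists_commutatorPow_ne_top [Finite N] [Nontrivial N] [Group.IsSolvable N] :
    ∃ p, p.Prime ∧ commutatorPow N p ≠ ⊤ := by
  have hlt := Group.IsSolvable.commutator_lt_top_of_nontrivial N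
  have hcard : Nat.card (Abelianization N) ≠ 1 := fun h =>
    hlt.ne (Subgroup.index_eq_one.mp h)
  obtain ⟨p, hp, hdvd⟩ := Nat.exists_prime_and_dvd hcard
  refine ⟨p, hp, fun htop => ?_⟩
  have := Fact.mk hp
  -- By Cauchy, the `p`-th power map on the finite abelianization is not injective, hence not
  -- surjective.
  obtain ⟨x, hx⟩ := exists_prime_orderOf_dvd_card' p hdvd
  have hsurj : Function.Surjective (powMonoidHom p : Abelianization N →* Abelianization N) := by
    intro a
    obtain ⟨n, rfl⟩ := QuotientGroup.mk_surjective a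
    exact (htop ▸ mem_top n : n ∈ commutatorPow N p)
  have hinj := Finite.injective_iff_surjective.mpr hsurj
  have hx1 : x = 1 := hinj (by simp [← hx, pow_orderOf_eq_one])
  rw [hx1, orderOf_one] at hx
  exact hp.one_lt.ne hx

theorem isPGroup_quotient_commutatorPow : IsPGroup p (N ⧸ commutatorPow N p) := by
  intro x
  obtain ⟨n, rfl⟩ := QuotientGroup.mk_surjective x
  refine ⟨1, ?_⟩
  rw [pow_one, ← QuotientGroup.mk_pow, QuotientGroup.eq_one_iff]
  exact pow_mem_commutatorPow n

end Subgroup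

/-! ### Transfer of nilpotency and solvability -/

namespace characterTable

open ConjClasses

variable {G H : Type*} [Group G] [Finite G] [Group H] [Finite H] {α : Irr G ≃ Irr H}
  {β : ConjClasses G ≃ ConjClasses H}

theorem _root_.ConjClasses.Corresponds.isNilpotent
    (hαβ : ∀ χ c, characterTable H (α χ) (β c) = characterTable G χ c) {N : Subgroup G} [N.Normal]
    {M : Subgroup H} (hNM : Corresponds β N M) (hN : Group.IsNilpotent N) :
    Group.IsNilpotent M := by
  have hsylow := (Group.isNilpotent_of_finite_tfae (G := N)).out 0 3
  have hsylow' := (Group.isNilpotent_of_finite_tfae (G := M)).out 0 3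
  rw [hsylow']
  intro p hp Q
  obtain ⟨P⟩ := (inferInstance : Nonempty (Sylow p N))
  have hP : (P : Subgroup N).Normal := hsylow.mp hN p hp P
  -- Makes the image of `P` normal in `G`, as its counterpart requires.
  have hPc := P.characteristic_of_normal hP
  obtain ⟨L, hL, hPL⟩ := exists_corresponds hαβ ((P : Subgroup N).map N.subtype)
  have hLM : L ≤ M := hPL.le hNM (Subgroup.map_subtype_le _)
  have hcard : Nat.card (L.subgroupOf M) = p ^ (Nat.card M).factorization p := by
    rw [Nat.card_congr (Subgroup.subgroupOfEquivOfLe hLM).toEquiv, hPL.card_eq hαβ,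
      Subgroup.card_map_of_injective N.subtype_injective, hNM.card_eq hαβ,
      Sylow.card_eq_multiplicity]
  let Q' : Sylow p M := Sylow.ofCard _ hcard
  have hQ' : (Q' : Subgroup M).Normal := hL.subgroupOf M
  have : Subsingleton (Sylow p M) := Sylow.unique_of_normal Q' hQ' |>.instSubsingleton
  rw [Subsingleton.elim Q Q']
  exact hQ'

theorem _root_.ConjClasses.Corresponds.isSolvable
    (hαβ : ∀ χ c, characterTable H (α χ) (β c) = characterTable G χ c) {N : Subgroup G} [N.Normal]
    {M : Subgroup H} (hNM : Corresponds β N M) (hN : Group.IsSolvable N) :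
    Group.IsSolvable M := by
  induction hn : Nat.card N using Nat.strong_induction_on generalizing N M with
  | _ n ih =>
  rcases subsingleton_or_nontrivial N with hs | hs
  · have : Subsingleton M := by
      rw [← Finite.card_le_one_iff_subsingleton, hNM.card_eq hαβ,
        Finite.card_le_one_iff_subsingleton]
      exact hs
    exact Group.isSolvable_of_top_eq_bot _ (Subsingleton.elim _ _)
  obtain ⟨p, hp, hne⟩ := Subgroup.exists_commutatorPow_ne_top (N := N)
  have := Fact.mk hp
  let S := Subgroup.commutatorPow N p
  have hScard : Nat.card (S.map N.subtype) = Nat.card S :=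
    Subgroup.card_map_of_injective N.subtype_injective
  obtain ⟨L, hL, hSL⟩ := exists_corresponds hαβ (S.map N.subtype)
  have hLM : L ≤ M := hSL.le hNM (Subgroup.map_subtype_le _)
  have hlt : Nat.card (S.map N.subtype) < n := by
    rw [hScard, ← hn]
    exact lt_of_le_of_ne (Subgroup.card_le_card_group S)
      fun h => hne (Subgroup.eq_top_of_card_eq _ h)
  have hsolv : Group.IsSolvable (S.map N.subtype) :=
    Group.isSolvable_of_surjective (f := N.subtype.subgroupMap S)
      (MonoidHom.subgroupMap_surjective _ _)
  have hLsolv : Group.IsSolvable L := ih _ hlt hSL hsolv rfl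
  have hLcard : Nat.card (L.subgroupOf M) = Nat.card S := by
    rw [Nat.card_congr (Subgroup.subgroupOfEquivOfLe hLM).toEquiv, hSL.card_eq hαβ, hScard]
  have hnormal : (L.subgroupOf M).Normal := hL.subgroupOf M
  -- Only the order of the quotient is transferred; this suffices because being a `p`-group depends
  -- only on the order.
  have hquot : Nat.card (M ⧸ L.subgroupOf M) = Nat.card (N ⧸ S) := by
    have h1 := (L.subgroupOf M).card_eq_card_quotient_mul_card_subgroup
    rw [hNM.card_eq hαβ, S.card_eq_card_quotient_mul_card_subgroup, hLcard] at h1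
    exact (Nat.eq_of_mul_eq_mul_right Nat.card_pos h1).symm
  obtain ⟨k, hk⟩ := IsPGroup.iff_card.mp
    (Subgroup.isPGroup_quotient_commutatorPow (N := N) (p := p))
  have hpgroup : IsPGroup p (M ⧸ L.subgroupOf M) := IsPGroup.of_card (hquot.trans hk)
  have hnilp := hpgroup.isNilpotent
  rw [Group.isSolvable_iff_subgroup_quotient (L.subgroupOf M)]
  exact ⟨Group.isSolvable_of_isSolvable_injective
    (f := (Subgroup.subgroupOfEquivOfLe hLM).toMonoidHom)
    (Subgroup.subgroupOfEquivOfLe hLM).injective,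
    _root_.IsNilpotent.to_isSolvable (h := hnilp)⟩

end characterTable

/-- The character table of a finite group `G` (up to the order of its rows and columns) determines
whether a normal subgroup `N`, given by the columns that belong to it, is nilpotent and whether it
is solvable: a second group with the same table and a normal subgroup that occupies the same columns
gives the same answers. -/
theorem proposition3p1 {G H : Type*} [Group G] [Finite G] [Group H] [Finite H]
    (α : Irr G ≃ Irr H) (β : ConjClasses G ≃ ConjClasses H)
    (hαβ : ∀ (χ : Irr G) (c : ConjClasses G),
      characterTable H (α χ) (β c) = characterTable G χ c)
    (N : Subgroup G) (hN : N.Normal) (M : Subgroup H) (hM : M.Normal)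
    (hNM : β '' classesIn N = classesIn M) :
    (Group.IsNilpotent N ↔ Group.IsNilpotent M) ∧ (Group.IsSolvable N ↔ Group.IsSolvable M) := by
  have h := ConjClasses.Corresponds.of_image_classesIn hN hM hNM
  have h' : ConjClasses.Corresponds β.symm M N := fun x g hxg =>
    (h g x ((β.symm_apply_eq.mp hxg).symm)).symm
  have hαβ' := characterTable.symm_apply hαβ
  exact ⟨⟨h.isNilpotent hαβ, h'.isNilpotent hαβ'⟩, ⟨h.isSolvable hαβ, h'.isSolvable hαβ'⟩⟩
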